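/- Let $2\le k\le n$, let $\bar x\in\mathbb R^n$ with $\|\bar x\|_0=k$ (exactly $k$ nonzero entries) and $\|\bar x\|_2=1$, and let $c=\min\{|\bar x_i| : \bar x_i\neq 0\}$. Let $\beta\ge 0$, $t\in\mathbb R$, and $\bar\Sigma=\beta\,\bar x\bar x^T+tI_n$, and let $\Sigma$ be a real symmetric $n\times n$ matrix. Let $L=\{sI_n: s\in\mathbb R\}$, let $\pi_{L^\perp}(A)=A-\tfrac{\operatorname{tr}A}{n}I_n$ be the orthogonal projection, for the trace inner product, onto the orthogonal complement of $L$ in the symmetric matrices, and let $\|\cdot\|$ denote the spectral norm of matrices. Suppose that $$\|\pi_{L^\perp}(\Sigma-\bar\Sigma)\|<\nu\beta\qquad\text{for some real } \nu<\min\Big\{\tfrac12\Big(\tfrac32+\tfrac{3+4\sqrt2}{c}\Big)^{-1},\ \tfrac{c^2}{4}\Big\}.$$ Then the semidefinite relaxation $$\max_{X}\ \operatorname{tr}(\Sigma X)\quad\text{s.t.}\quad X\in\mathbb R^{n\times n}\text{ symmetric},\quad \operatorname{tr}(X)=1,\quad k\operatorname{diag}(X)\succeq X\succeq 0$$ (where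 $\operatorname{diag}(X)$ is the diagonal matrix with the diagonal of $X$) of the sparse PCA problem $$\max_{x\in\mathbb R^n}\ x^T\Sigma x\quad\text{s.t.}\quad \|x\|_0\le k,\quad \|x\|_2=1$$ is exact: it has an optimal solution, and every optimal solution is a rank-one matrix $X=xx^T$ in which $x$ is an optimal solution of the sparse PCA problem. -/

import Mathlib

open scoped Matrix.Norms.L2Operator

namespace SparsePCA

/-- The number of nonzero entries of a vector. -/
noncomputable def zeroNorm {n : ℕ} (x : EuclideanSpace ℝ (Fin n)) : ℕ :=
  hammingNorm x.ofLp

/-- The rank-one matrix `x xᵀ`. -/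
def outer {n : ℕ} (x : EuclideanSpace ℝ (Fin n)) : Matrix (Fin n) (Fin n) ℝ :=
  Matrix.vecMulVec x.ofLp x.ofLp

/-- The trace inner product `A • B = tr (Bᵀ A)`. -/
def traceInner {n : ℕ} (A B : Matrix (Fin n) (Fin n) ℝ) : ℝ :=
  (B.transpose * A).trace

/-- The set of symmetric `X` with `k diag X ⪰ X ⪰ 0`, where `diag X` keeps only the diagonal
of `X`. Symmetry is part of `Matrix.PosSemidef`. -/
def spartrahedron (n k : ℕ) : Set (Matrix (Fin n) (Fin n) ℝ) :=
  {X | ((k : ℝ) • Matrix.diagonal X.diag - X).PosSemidef ∧ X.PosSemidef}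

/-- The feasible set of sparse PCA: unit vectors with at most `k` nonzero entries. -/
def spcaFeasible (n k : ℕ) : Set (EuclideanSpace ℝ (Fin n)) :=
  {x | zeroNorm x ≤ k ∧ ‖x‖ = 1}

/-- `x` maximizes `xᵀ A x` over the `k`-sparse unit vectors. -/
def IsSpcaOptimal {n : ℕ} (A : Matrix (Fin n) (Fin n) ℝ) (k : ℕ)
    (x : EuclideanSpace ℝ (Fin n)) : Prop :=
  x ∈ spcaFeasible n k ∧
    ∀ y ∈ spcaFeasible n k, y.ofLp ⬝ᵥ A.mulVec y.ofLp ≤ x.ofLp ⬝ᵥ A.mulVec x.ofLp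

/-- The feasible set of the semidefinite relaxation of sparse PCA. -/
def sdpFeasible (n k : ℕ) : Set (Matrix (Fin n) (Fin n) ℝ) :=
  {X | X.trace = 1 ∧ X ∈ spartrahedron n k}

/-- `X` maximizes `A • X` over the feasible set of the semidefinite relaxation. -/
def IsSdpOptimal {n : ℕ} (A : Matrix (Fin n) (Fin n) ℝ) (k : ℕ)
    (X : Matrix (Fin n) (Fin n) ℝ) : Prop :=
  X ∈ sdpFeasible n k ∧ ∀ Y ∈ sdpFeasible n k, traceInner A Y ≤ traceInner A X

/-- The relaxation is exact for the objective matrix `A`: it has an optimal solution, and every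
optimal solution is a rank-one matrix `x xᵀ` in which `x` is optimal for sparse PCA. -/
def SdpExact {n : ℕ} (A : Matrix (Fin n) (Fin n) ℝ) (k : ℕ) : Prop :=
  (∃ X, IsSdpOptimal A k X) ∧
    ∀ X, IsSdpOptimal A k X → X.rank = 1 ∧ ∃ x, X = outer x ∧ IsSpcaOptimal A k x

/-- The orthogonal projection, for the trace inner product, onto the orthogonal complement of
the line `L = {t I : t ∈ ℝ}`. -/
noncomputable def projLPerp {n : ℕ} (A : Matrix (Fin n) (Fin n) ℝ) :
    Matrix (Fin n) (Fin n) ℝ :=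
  A - (A.trace / n) • (1 : Matrix (Fin n) (Fin n) ℝ)

theorem projLPerp_orthogonal {n : ℕ} (A : Matrix (Fin n) (Fin n) ℝ) (t : ℝ) :
    traceInner (projLPerp A) (t • (1 : Matrix (Fin n) (Fin n) ℝ)) = 0 := by
  rcases Nat.eq_zero_or_pos n with rfl | hn
  · simp [traceInner, Matrix.trace]
  · have : (n : ℝ) ≠ 0 := by positivity
    simp [traceInner, projLPerp, Matrix.trace_sub, Matrix.trace_smul, this]

theorem sub_projLPerp_mem {n : ℕ} (A : Matrix (Fin n) (Fin n) ℝ) :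
    ∃ t : ℝ, A - projLPerp A = t • (1 : Matrix (Fin n) (Fin n) ℝ) :=
  ⟨A.trace / n, by simp [projLPerp]⟩

end SparsePCA

/-!
Adding a multiple of the identity or rescaling by a positive factor changes the objective on
trace-one matrices only by an increasing affine map, so the question is about
`A = x̄ x̄ᵀ + E` with `E` symmetric and `‖E‖ ≤ c / 16`; the hypothesis on `ν` gives this bound.

Let `x` be the top eigenvector of the compression of `A` to the support `I` of `x̄`, with
eigenvalue `μ ≥ 1 - ‖E‖` (`exists_supported_top_eigenvector`). The eigenvalue equation forces
`|x i| ≥ 3 c / 4` on `I`, so `x` has the same support as `x̄`. A rank-one dual certificate shows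
that `x xᵀ` is the only maximizer of the relaxation: put `τ = c² / 5`, `η i = 1 / x i` on `I` and
`η i = (A x) i / τ` off `I`. Since `η · x = k`, the slack matrix

  `Z = μ I - A - τ diag (η²) + (τ / k) η ηᵀ`

satisfies `Z x = 0`. On the orthogonal complement of `x` the form of `Z` is at least `1 / 8` of
the squared norm: there `(x̄ · v)² ≤ 2 ‖E‖ |v|²`, because `x` is almost parallel to `x̄`, every
`τ η i²` is at most `3 / 8`, and the last summand of `Z` is nonnegative. For feasible `X`,

  `⟨A, X⟩ = μ - ⟨Z, X⟩ - (τ / k) ηᵀ (k diag X - X) η`,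

so `⟨A, X⟩ ≤ μ`, with equality only if the range of `X` is spanned by `x`
(`traceInner_lt_of_certificate`). Finally `x xᵀ` attains `μ`, and every `y yᵀ` with `y` feasible
for sparse PCA is feasible for the relaxation, so `x` is optimal for sparse PCA as well.
-/

namespace SparsePCA

open Matrix

/-! ### Rank-one feasible points -/

theorem traceInner_outer {n : ℕ} (A : Matrix (Fin n) (Fin n) ℝ) (x : EuclideanSpace ℝ (Fin n)) :
    traceInner A (outer x) = x.ofLp ⬝ᵥ A *ᵥ x.ofLp := by
  simp [traceInner, outer, transpose_vecMulVec, vecMulVec_mul, trace_vecMulVec,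
    dotProduct_mulVec, dotProduct_comm]

theorem traceInner_sum_vecMulVec {n m : ℕ} (A : Matrix (Fin n) (Fin n) ℝ)
    (v : Fin m → Fin n → ℝ) :
    traceInner A (∑ l, vecMulVec (v l) (v l)) = ∑ l, v l ⬝ᵥ A *ᵥ v l := by
  simp [traceInner, transpose_sum, Finset.sum_mul, transpose_vecMulVec, vecMulVec_mul,
    trace_vecMulVec, trace_sum, dotProduct_mulVec, dotProduct_comm]

theorem norm_eq_one_iff_dotProduct {n : ℕ} (x : EuclideanSpace ℝ (Fin n)) :
    ‖x‖ = 1 ↔ x.ofLp ⬝ᵥ x.ofLp = 1 := by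
  rw [← sq_eq_sq₀ (norm_nonneg x) zero_le_one, EuclideanSpace.real_norm_sq_eq]
  simp [dotProduct, pow_two]

theorem dotProduct_diagonal_diag_outer {n : ℕ} (x : EuclideanSpace ℝ (Fin n)) (v : Fin n → ℝ) :
    v ⬝ᵥ diagonal (outer x).diag *ᵥ v = ∑ i, (x i * v i) ^ 2 := by
  simp only [dotProduct, mulVec_diagonal]
  refine Finset.sum_congr rfl fun i _ => ?_
  simp [outer, vecMulVec_apply]
  ring

/-- For a `k`-sparse `x`, the inequality `k diag (x xᵀ) ⪰ x xᵀ` is the Cauchy–Schwarz inequality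
on the support of `x`. -/
theorem outer_mem_sdpFeasible {n k : ℕ} {x : EuclideanSpace ℝ (Fin n)}
    (hx : x ∈ spcaFeasible n k) : outer x ∈ sdpFeasible n k := by
  obtain ⟨hcard, hnorm⟩ := hx
  have hpsd : (outer x).PosSemidef := by
    simpa [outer] using posSemidef_vecMulVec_self_star (R := ℝ) x.ofLp
  refine ⟨?_, ?_, hpsd⟩
  · rw [outer, trace_vecMulVec, (norm_eq_one_iff_dotProduct x).1 hnorm]
  refine .of_dotProduct_mulVec_nonneg ?_ fun v => ?_
  · exact ((isHermitian_diagonal _).smul (IsSelfAdjoint.all _)).sub hpsd.1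
  have hq : v ⬝ᵥ outer x *ᵥ v = (∑ i, x i * v i) ^ 2 := by
    simp only [outer, vecMulVec_mulVec, dotProduct, Pi.smul_apply, MulOpposite.smul_eq_mul_unop,
      MulOpposite.unop_op, pow_two]
    rw [Finset.sum_mul]
    exact Finset.sum_congr rfl fun i _ => by ring
  rw [star_trivial, sub_mulVec, dotProduct_sub, smul_mulVec, dotProduct_smul,
    dotProduct_diagonal_diag_outer, hq, smul_eq_mul, sub_nonneg]
  have hsum : ∑ i, x i * v i = ∑ i with x i ≠ 0, x i * v i := by
    refine (Finset.sum_filter_of_ne fun i _ h => ?_).symm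
    exact left_ne_zero_of_mul h
  calc (∑ i, x i * v i) ^ 2 = (∑ i with x i ≠ 0, x i * v i) ^ 2 := by rw [hsum]
    _ ≤ (Finset.card {i | x i ≠ 0}) * ∑ i with x i ≠ 0, (x i * v i) ^ 2 :=
      sq_sum_le_card_mul_sum_sq
    _ ≤ k * ∑ i, (x i * v i) ^ 2 := by
      gcongr
      · exact hcard
      · exact Finset.subset_univ _

/-- If `x xᵀ` strictly beats every other feasible point, the relaxation is exact. -/
theorem SdpExact.of_strict {n k : ℕ} {A : Matrix (Fin n) (Fin n) ℝ}
    {x : EuclideanSpace ℝ (Fin n)} (hx : x ∈ spcaFeasible n k)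
    (h : ∀ X ∈ sdpFeasible n k, X ≠ outer x → traceInner A X < traceInner A (outer x)) :
    SdpExact A k := by
  have hle : ∀ X ∈ sdpFeasible n k, traceInner A X ≤ traceInner A (outer x) := fun X hX => by
    rcases eq_or_ne X (outer x) with rfl | hne
    · exact le_rfl
    · exact (h X hX hne).le
  have hmem := outer_mem_sdpFeasible hx
  refine ⟨⟨outer x, hmem, hle⟩, fun X hX => ?_⟩
  have hXx : X = outer x := by
    by_contra hne
    exact (hX.2 _ hmem).not_gt (h X hX.1 hne)
  have hx0 : x.ofLp ≠ 0 := fun h0 => by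
    have := (norm_eq_one_iff_dotProduct x).1 hx.2
    simp [h0] at this
  refine ⟨?_, x, hXx, hx, fun y hy => ?_⟩
  · rw [hXx, outer]
    refine le_antisymm (rank_vecMulVec_le _ _) (Nat.one_le_iff_ne_zero.2 fun hr => hx0 ?_)
    have h0 : (vecMulVec x.ofLp x.ofLp).mulVecLin = 0 :=
      LinearMap.range_eq_bot.1 (Submodule.finrank_eq_zero.1 hr)
    have h1 : vecMulVec x.ofLp x.ofLp *ᵥ x.ofLp = 0 := by
      rw [← mulVecLin_apply, h0, LinearMap.zero_apply]
    simpa [vecMulVec_mulVec, (norm_eq_one_iff_dotProduct x).1 hx.2] using h1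
  · simpa only [traceInner_outer] using hle _ (outer_mem_sdpFeasible hy)

/-! ### Weak duality -/

/-- Weak duality with a rank-one multiplier `(τ / k) η ηᵀ` for the constraint `k diag X ⪰ X`.
The slack matrix `Z = μ I - A - τ diag (η²) + (τ / k) η ηᵀ` annihilates `x` by `hker`, and it is
positive definite on the orthogonal complement of `x` by `hgap`, so only `x xᵀ` attains the
bound `μ`. -/
theorem traceInner_lt_of_certificate {n k : ℕ} (hk : k ≠ 0) {A : Matrix (Fin n) (Fin n) ℝ}
    (hA : A.IsSymm) {x : EuclideanSpace ℝ (Fin n)} (hx : x.ofLp ⬝ᵥ x.ofLp = 1)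
    {η : Fin n → ℝ} {μ τ m : ℝ} (hτ : 0 ≤ τ) (hm : 0 < m)
    (hker : ∀ i, (A *ᵥ x.ofLp) i =
      μ * x i - τ * η i ^ 2 * x i + τ / k * (η ⬝ᵥ x.ofLp) * η i)
    (hgap : ∀ v : Fin n → ℝ, v ⬝ᵥ x.ofLp = 0 →
      v ⬝ᵥ A *ᵥ v + τ * ∑ i, η i ^ 2 * v i ^ 2 + m * (v ⬝ᵥ v) ≤ μ * (v ⬝ᵥ v))
    {X : Matrix (Fin n) (Fin n) ℝ} (hX : X ∈ sdpFeasible n k) (hne : X ≠ outer x) :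
    traceInner A X < μ := by
  obtain ⟨htr, hdiag, hpsd⟩ := hX
  have hk' : (k : ℝ) ≠ 0 := by exact_mod_cast hk
  set Z : Matrix (Fin n) (Fin n) ℝ :=
    μ • 1 - A - τ • diagonal (fun i => η i ^ 2) + (τ / k) • vecMulVec η η with hZ
  have hZsymm : Zᵀ = Z := by
    simp [hZ, transpose_vecMulVec, hA.eq]
  have hZv : ∀ v, Z *ᵥ v = μ • v - A *ᵥ v - τ • (fun i => η i ^ 2 * v i)
      + (τ / k * (η ⬝ᵥ v)) • η := fun v => by
    ext i
    simp [hZ, add_mulVec, sub_mulVec, smul_mulVec, mulVec_diagonal, vecMulVec_mulVec]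
    ring
  have hZx : Z *ᵥ x.ofLp = 0 := by
    rw [hZv]
    ext i
    simp [hker i]
    ring
  have hZquad : ∀ v, m * (v ⬝ᵥ v - (v ⬝ᵥ x.ofLp) ^ 2) ≤ v ⬝ᵥ Z *ᵥ v := fun v => by
    set a := v ⬝ᵥ x.ofLp with ha
    set w := v - a • x.ofLp with hw
    have hwx : w ⬝ᵥ x.ofLp = 0 := by
      simp [hw, sub_dotProduct, smul_dotProduct, hx, ← ha]
    have hww : w ⬝ᵥ w = v ⬝ᵥ v - a ^ 2 := by
      have : w ⬝ᵥ w = w ⬝ᵥ v - a * (w ⬝ᵥ x.ofLp) := by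
        conv_lhs => rw [hw, dotProduct_sub, dotProduct_smul, ← hw, smul_eq_mul]
      rw [this, hwx, hw, sub_dotProduct, smul_dotProduct, dotProduct_comm x.ofLp v, ← ha,
        smul_eq_mul]
      ring
    have hxZ : x.ofLp ⬝ᵥ Z *ᵥ v = 0 := by
      rw [dotProduct_mulVec, ← mulVec_transpose, hZsymm, hZx, zero_dotProduct]
    have hquad : v ⬝ᵥ Z *ᵥ v = w ⬝ᵥ Z *ᵥ w := by
      rw [hw, mulVec_sub, mulVec_smul, hZx, smul_zero, sub_zero, sub_dotProduct, smul_dotProduct,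
        hxZ, smul_zero, sub_zero]
    have hexp : w ⬝ᵥ Z *ᵥ w = μ * (w ⬝ᵥ w) - w ⬝ᵥ A *ᵥ w - τ * ∑ i, η i ^ 2 * w i ^ 2
        + τ / k * (η ⬝ᵥ w) ^ 2 := by
      have hd : w ⬝ᵥ (fun i => η i ^ 2 * w i) = ∑ i, η i ^ 2 * w i ^ 2 :=
        Finset.sum_congr rfl fun i _ => by ring
      rw [hZv, dotProduct_add, dotProduct_sub, dotProduct_sub, dotProduct_smul, dotProduct_smul,
        dotProduct_smul, hd, dotProduct_comm w η]
      simp only [smul_eq_mul]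
      ring
    have h1 := hgap w hwx
    have h2 : 0 ≤ τ / k * (η ⬝ᵥ w) ^ 2 := by positivity
    rw [hquad, hexp, ← hww]
    linarith
  obtain ⟨p, v, hv⟩ := posSemidef_iff_eq_sum_vecMulVec.1 hpsd
  simp only [star_trivial] at hv
  have htrv : ∑ l, v l ⬝ᵥ v l = 1 := by
    rw [← htr, hv, trace_sum]
    simp [trace_vecMulVec]
  -- The constraint `k diag X ⪰ X` tested on `η`.
  have hη : 0 ≤ (k : ℝ) * ∑ i, η i ^ 2 * X i i - η ⬝ᵥ X *ᵥ η := by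
    have hd : η ⬝ᵥ diagonal X.diag *ᵥ η = ∑ i, η i ^ 2 * X i i := by
      simp only [dotProduct, mulVec_diagonal, diag_apply]
      exact Finset.sum_congr rfl fun i _ => by ring
    have h := hdiag.dotProduct_mulVec_nonneg η
    rwa [star_trivial, sub_mulVec, dotProduct_sub, smul_mulVec, dotProduct_smul, hd] at h
  have hZX : traceInner Z X = μ - traceInner A X - τ / k *
      ((k : ℝ) * ∑ i, η i ^ 2 * X i i - η ⬝ᵥ X *ᵥ η) := by
    have hXs : Xᵀ = X := hpsd.1.eq
    have hd : (X * diagonal fun i => η i ^ 2).trace = ∑ i, η i ^ 2 * X i i := by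
      simp [trace, mul_diagonal, mul_comm]
    have ho : (X * vecMulVec η η).trace = η ⬝ᵥ X *ᵥ η := by
      rw [mul_vecMulVec, trace_vecMulVec, dotProduct_comm]
    simp only [traceInner, hXs, hZ, mul_add, mul_sub, trace_add, trace_sub, Matrix.mul_smul,
      trace_smul,
      mul_one, htr, hd, ho, smul_eq_mul]
    field_simp
    ring
  have hterm : ∀ l, 0 ≤ v l ⬝ᵥ v l - (v l ⬝ᵥ x.ofLp) ^ 2 := fun l => by
    set a := v l ⬝ᵥ x.ofLp with ha
    have h : 0 ≤ (v l - a • x.ofLp) ⬝ᵥ (v l - a • x.ofLp) :=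
      Finset.sum_nonneg fun i _ => mul_self_nonneg _
    simp only [sub_dotProduct, dotProduct_sub, smul_dotProduct, dotProduct_smul, hx, smul_eq_mul,
      dotProduct_comm x.ofLp (v l), ← ha] at h
    linarith
  by_contra! hlt
  have hkη : 0 ≤ τ / k * ((k : ℝ) * ∑ i, η i ^ 2 * X i i - η ⬝ᵥ X *ᵥ η) :=
    mul_nonneg (by positivity) hη
  have hsum : m * ∑ l, (v l ⬝ᵥ v l - (v l ⬝ᵥ x.ofLp) ^ 2) ≤ 0 := by
    calc _ ≤ ∑ l, v l ⬝ᵥ Z *ᵥ v l := by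
          rw [Finset.mul_sum]
          exact Finset.sum_le_sum fun l _ => hZquad (v l)
      _ = traceInner Z X := by rw [hv, traceInner_sum_vecMulVec]
      _ ≤ 0 := by rw [hZX]; linarith
  have hsum0 : ∑ l, (v l ⬝ᵥ v l - (v l ⬝ᵥ x.ofLp) ^ 2) = 0 :=
    le_antisymm (nonpos_of_mul_nonpos_right hsum hm) (Finset.sum_nonneg fun l _ => hterm l)
  have hzero := (Finset.sum_eq_zero_iff_of_nonneg fun l _ => hterm l).1 hsum0
  -- Equality in Cauchy–Schwarz: each `v l` is a multiple of `x`.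
  have hpar : ∀ l, v l = (v l ⬝ᵥ x.ofLp) • x.ofLp := fun l => by
    have h0 := hzero l (Finset.mem_univ l)
    rw [← sub_eq_zero, ← dotProduct_self_eq_zero]
    simp only [sub_dotProduct, dotProduct_sub, smul_dotProduct, dotProduct_smul, hx, smul_eq_mul,
      dotProduct_comm x.ofLp (v l)]
    linarith
  refine hne ?_
  have hone : ∑ l, (v l ⬝ᵥ x.ofLp) ^ 2 = 1 := by
    rw [← htrv, ← sub_eq_zero, ← Finset.sum_sub_distrib, ← neg_eq_zero, ← Finset.sum_neg_distrib,
      ← hsum0]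
    exact Finset.sum_congr rfl fun l _ => by ring
  calc X = ∑ l, vecMulVec (v l) (v l) := hv
    _ = ∑ l, (v l ⬝ᵥ x.ofLp) ^ 2 • outer x := Finset.sum_congr rfl fun l _ => by
        conv_lhs => rw [hpar l]
        simp [outer, smul_vecMulVec, vecMulVec_smul, smul_smul, pow_two]
    _ = outer x := by rw [← Finset.sum_smul, hone, one_smul]

/-! ### Top eigenvectors with prescribed support -/

/-- The maximizer of the quadratic form of `B` on the unit sphere is an eigenvector. -/
theorem exists_top_eigenvector {n : ℕ} {B : Matrix (Fin n) (Fin n) ℝ} (hB : B.IsSymm)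
    {y : Fin n → ℝ} (hy : y ⬝ᵥ y = 1) :
    ∃ (x : Fin n → ℝ) (μ : ℝ), x ⬝ᵥ x = 1 ∧ B *ᵥ x = μ • x ∧ y ⬝ᵥ B *ᵥ y ≤ μ := by
  let T := toEuclideanCLM (n := Fin n) (𝕜 := ℝ) B
  have hT : IsSelfAdjoint T := by
    refine IsSelfAdjoint.map (x := B) ?_ (toEuclideanCLM (n := Fin n) (𝕜 := ℝ))
    exact (conjTranspose_eq_transpose_of_trivial B).trans hB
  have hquad : ∀ z : EuclideanSpace ℝ (Fin n),
      T.reApplyInnerSelf z = z.ofLp ⬝ᵥ B *ᵥ z.ofLp := fun z => by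
    simp [T, ContinuousLinearMap.reApplyInnerSelf_apply, EuclideanSpace.inner_eq_star_dotProduct]
  have hy' : ‖WithLp.toLp 2 y‖ = 1 := (norm_eq_one_iff_dotProduct _).2 hy
  obtain ⟨x, hx, hmax⟩ := (isCompact_sphere (0 : EuclideanSpace ℝ (Fin n)) 1).exists_isMaxOn
    ⟨WithLp.toLp 2 y, by simp [hy']⟩ T.reApplyInnerSelf_continuous.continuousOn
  have hx1 : ‖x‖ = 1 := by simpa using hx
  have hx0 : x ≠ 0 := fun h => by simp [h] at hx1
  have heig := hT.hasEigenvector_of_isLocalExtrOn hx0 (Or.inr (hx1 ▸ hmax).localize)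
  refine ⟨x.ofLp, T.rayleighQuotient x, (norm_eq_one_iff_dotProduct x).1 hx1, ?_, ?_⟩
  · have h := congrArg WithLp.ofLp heig.apply_eq_smul
    simpa [T] using h
  · have h := hmax (show WithLp.toLp 2 y ∈ Metric.sphere 0 1 by simp [hy'])
    simp only [Set.mem_ofPred_eq, hquad] at h
    simpa [ContinuousLinearMap.rayleighQuotient, hx1, hquad] using h

/-- If the quadratic form of `A` is positive at a unit vector supported on `s`, the compression
of `A` to `s` has a top eigenvector `x`, and `x` is supported on `s`. The vector `A *ᵥ x` need not
vanish off `s`. -/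
theorem exists_supported_top_eigenvector {n : ℕ} {A : Matrix (Fin n) (Fin n) ℝ} (hA : A.IsSymm)
    (s : Set (Fin n)) {y : Fin n → ℝ} (hy : y ⬝ᵥ y = 1) (hys : ∀ i ∉ s, y i = 0)
    (hpos : 0 < y ⬝ᵥ A *ᵥ y) :
    ∃ (x : Fin n → ℝ) (μ : ℝ), x ⬝ᵥ x = 1 ∧ (∀ i ∉ s, x i = 0) ∧
      (∀ i ∈ s, (A *ᵥ x) i = μ * x i) ∧ y ⬝ᵥ A *ᵥ y ≤ μ := by
  classical
  let B : Matrix (Fin n) (Fin n) ℝ := of fun i j => if i ∈ s ∧ j ∈ s then A i j else 0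
  have hB : B.IsSymm := by
    ext i j
    simp only [B, transpose_apply, of_apply, and_comm, hA.apply]
  have hBv : ∀ v : Fin n → ℝ, (∀ i ∉ s, v i = 0) → ∀ i ∈ s, (B *ᵥ v) i = (A *ᵥ v) i := by
    intro v hv i hi
    simp only [mulVec, dotProduct]
    refine Finset.sum_congr rfl fun j _ => ?_
    by_cases hj : j ∈ s
    · simp [B, hi, hj]
    · simp [hv j hj]
  have hyB : y ⬝ᵥ B *ᵥ y = y ⬝ᵥ A *ᵥ y := by
    refine Finset.sum_congr rfl fun i _ => ?_
    by_cases hi : i ∈ s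
    · rw [hBv y hys i hi]
    · simp [hys i hi]
  obtain ⟨x, μ, hx, hBx, hμ⟩ := exists_top_eigenvector hB hy
  rw [hyB] at hμ
  -- The compression `B` maps into vectors supported on `s`, and its eigenvalue `μ` is nonzero.
  have hxs : ∀ i ∉ s, x i = 0 := fun i hi => by
    have h := congrFun hBx i
    have h0 : (B *ᵥ x) i = 0 := by simp [mulVec, dotProduct, B, hi]
    rw [h0, Pi.smul_apply, smul_eq_mul, zero_eq_mul] at h
    exact h.resolve_left (hpos.trans_le hμ).ne'
  refine ⟨x, μ, hx, hxs, fun i hi => ?_, hμ⟩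
  rw [← hBv x hxs i hi, hBx, Pi.smul_apply, smul_eq_mul]

/-! ### Quadratic form estimates -/

theorem sq_dotProduct_le {n : ℕ} (v w : Fin n → ℝ) :
    (v ⬝ᵥ w) ^ 2 ≤ (v ⬝ᵥ v) * (w ⬝ᵥ w) := by
  simpa [dotProduct, pow_two] using Finset.sum_mul_sq_le_sq_mul_sq Finset.univ v w

theorem mulVec_dotProduct_self_le {n : ℕ} (E : Matrix (Fin n) (Fin n) ℝ) (v : Fin n → ℝ) :
    E *ᵥ v ⬝ᵥ E *ᵥ v ≤ ‖E‖ ^ 2 * (v ⬝ᵥ v) := by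
  have h := pow_le_pow_left₀ (norm_nonneg _) (l2_opNorm_mulVec E (WithLp.toLp 2 v)) 2
  rw [mul_pow, EuclideanSpace.real_norm_sq_eq, EuclideanSpace.real_norm_sq_eq] at h
  simpa [dotProduct, pow_two] using h

theorem abs_dotProduct_mulVec_le {n : ℕ} (E : Matrix (Fin n) (Fin n) ℝ) (v : Fin n → ℝ) :
    |v ⬝ᵥ E *ᵥ v| ≤ ‖E‖ * (v ⬝ᵥ v) := by
  have hv : 0 ≤ v ⬝ᵥ v := Finset.sum_nonneg fun i _ => mul_self_nonneg _
  refine abs_le_of_sq_le_sq ?_ (by positivity)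
  calc (v ⬝ᵥ E *ᵥ v) ^ 2 ≤ (v ⬝ᵥ v) * (E *ᵥ v ⬝ᵥ E *ᵥ v) := sq_dotProduct_le _ _
    _ ≤ (v ⬝ᵥ v) * (‖E‖ ^ 2 * (v ⬝ᵥ v)) := by gcongr; exact mulVec_dotProduct_self_le E v
    _ = (‖E‖ * (v ⬝ᵥ v)) ^ 2 := by ring

theorem sq_apply_le_dotProduct_self {n : ℕ} (v : Fin n → ℝ) (i : Fin n) :
    v i ^ 2 ≤ v ⬝ᵥ v := by
  rw [pow_two]
  exact Finset.single_le_sum (f := fun i => v i * v i) (fun i _ => mul_self_nonneg _)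
    (Finset.mem_univ i)

/-- Bessel's inequality for the orthonormal pair `x`, `v / |v|`. -/
theorem sq_dotProduct_le_of_orthogonal {n : ℕ} {x v : Fin n → ℝ} (hx : x ⬝ᵥ x = 1)
    (hvx : v ⬝ᵥ x = 0) (y : Fin n → ℝ) :
    (y ⬝ᵥ v) ^ 2 ≤ (y ⬝ᵥ y - (y ⬝ᵥ x) ^ 2) * (v ⬝ᵥ v) := by
  have h := sq_dotProduct_le (y - (y ⬝ᵥ x) • x) v
  simp only [sub_dotProduct, dotProduct_sub, smul_dotProduct, dotProduct_smul, smul_eq_mul, hx,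
    dotProduct_comm x v, hvx, dotProduct_comm x y] at h
  linarith

/-! ### Exactness near a sparse rank-one matrix -/

/-- Exactness in the normalized case: a perturbation of `x̄ x̄ᵀ` of norm at most `c / 16`, where
`c` bounds the nonzero entries of `x̄` from below. -/
theorem exists_strict_maximizer {n k : ℕ} (hk : k ≠ 0) {xbar : EuclideanSpace ℝ (Fin n)}
    (hcard : zeroNorm xbar = k) (hnorm : ‖xbar‖ = 1) {c : ℝ} (hc0 : 0 < c) (hc1 : c ≤ 1)
    (hc : ∀ i, xbar i ≠ 0 → c ≤ |xbar i|) {E : Matrix (Fin n) (Fin n) ℝ} (hE : E.IsSymm)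
    (hEc : ‖E‖ ≤ c / 16) :
    ∃ x ∈ spcaFeasible n k, ∀ X ∈ sdpFeasible n k, X ≠ outer x →
      traceInner (outer xbar + E) X < traceInner (outer xbar + E) (outer x) := by
  set A := outer xbar + E with hAdef
  set e := ‖E‖ with he
  have he0 : 0 ≤ e := norm_nonneg E
  have hxx : xbar.ofLp ⬝ᵥ xbar.ofLp = 1 := (norm_eq_one_iff_dotProduct xbar).1 hnorm
  have hA : A.IsSymm := by
    have h : (outer xbar).IsSymm := transpose_vecMulVec _ _
    exact h.add hE
  have hAv : ∀ v i, (A *ᵥ v) i = (xbar.ofLp ⬝ᵥ v) * xbar i + (E *ᵥ v) i := fun v i => by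
    simp [hAdef, add_mulVec, outer, vecMulVec_mulVec]
  have hAq : ∀ v, v ⬝ᵥ A *ᵥ v = (xbar.ofLp ⬝ᵥ v) ^ 2 + v ⬝ᵥ E *ᵥ v := fun v => by
    simp only [hAdef, add_mulVec, dotProduct_add, outer, vecMulVec_mulVec, dotProduct_smul,
      MulOpposite.smul_eq_mul_unop, MulOpposite.unop_op, dotProduct_comm v xbar.ofLp, pow_two]
  have hEq : ∀ v, |v ⬝ᵥ E *ᵥ v| ≤ e * (v ⬝ᵥ v) := abs_dotProduct_mulVec_le E
  have hAbar : 1 - e ≤ xbar.ofLp ⬝ᵥ A *ᵥ xbar.ofLp := by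
    have := (abs_le.1 (hEq xbar.ofLp)).1
    rw [hAq, hxx]
    rw [hxx] at this
    linarith
  obtain ⟨x, μ, hx, hxs, heig, hμ⟩ := exists_supported_top_eigenvector hA {i | xbar i ≠ 0} hxx
    (fun i hi => by simpa using hi) (by linarith)
  replace hxs : ∀ i, xbar i = 0 → x i = 0 := fun i hi => hxs i (by simpa using hi)
  replace heig : ∀ i, xbar i ≠ 0 → (A *ᵥ x) i = μ * x i := fun i hi => heig i hi
  have hμx : x ⬝ᵥ A *ᵥ x = μ := by
    have h : x ⬝ᵥ A *ᵥ x = μ * (x ⬝ᵥ x) := by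
      simp only [dotProduct, Finset.mul_sum]
      refine Finset.sum_congr rfl fun i _ => ?_
      by_cases hi : xbar i = 0
      · simp [hxs i hi]
      · rw [heig i hi]
        ring
    rw [h, hx, mul_one]
  set a := xbar.ofLp ⬝ᵥ x with ha
  have hμa : μ ≤ a ^ 2 + e := by
    have := (abs_le.1 (hEq x)).2
    rw [hx] at this
    rw [← hμx, hAq]
    linarith
  have ha2 : 1 - 2 * e ≤ a ^ 2 := by linarith
  have ha1 : a ^ 2 ≤ 1 := by simpa [hxx, hx] using sq_dotProduct_le xbar.ofLp x
  have haabs : 1 - 2 * e ≤ |a| := by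
    have h1 : |a| ≤ 1 := (sq_le_one_iff_abs_le_one a).1 ha1
    have h2 : |a| ^ 2 = a ^ 2 := sq_abs a
    nlinarith [abs_nonneg a]
  have hEx : ∀ i, (E *ᵥ x) i ^ 2 ≤ e ^ 2 := fun i =>
    (sq_apply_le_dotProduct_self _ i).trans (by simpa [hx] using mulVec_dotProduct_self_le E x)
  have hμpos : 0 < μ := by linarith
  -- The eigenvalue equation on the support transfers the lower bound `c` from `x̄` to `x`.
  have hxlow : ∀ i, xbar i ≠ 0 → 3 / 4 * c ≤ |x i| := fun i hi => by
    have h1 : μ * x i = a * xbar i + (E *ᵥ x) i := by rw [← heig i hi, hAv]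
    have h2 : |(E *ᵥ x) i| ≤ e := abs_le_of_sq_le_sq (hEx i) he0
    have h3 : |a| * |xbar i| ≤ μ * |x i| + e := by
      have : a * xbar i = μ * x i - (E *ᵥ x) i := by linarith
      calc |a| * |xbar i| = |μ * x i - (E *ᵥ x) i| := by rw [← abs_mul, this]
        _ ≤ |μ * x i| + |(E *ᵥ x) i| := abs_sub _ _
        _ ≤ μ * |x i| + e := by rw [abs_mul, abs_of_pos hμpos]; linarith
    have h4 : (1 - 2 * e) * c ≤ |a| * |xbar i| :=
      mul_le_mul haabs (hc i hi) hc0.le (abs_nonneg a)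
    have h5 : μ * |x i| ≤ (1 + 1 / 16) * |x i| := by
      gcongr
      linarith
    nlinarith
  -- On the support `τ * η i ^ 2 ≤ (16 / 9) / 5`, which leaves room for the terms in `e ≤ 1 / 16`.
  set τ := c ^ 2 / 5 with hτ
  have hτ0 : 0 < τ := by positivity
  set η : Fin n → ℝ := fun i => if xbar i = 0 then (A *ᵥ x) i / τ else (x i)⁻¹ with hη
  have hηx : η ⬝ᵥ x = k := by
    rw [← hcard, zeroNorm, hammingNorm, Finset.card_filter, Nat.cast_sum]
    refine Finset.sum_congr rfl fun i _ => ?_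
    by_cases hi : xbar i = 0
    · simp [hi, hxs i hi]
    · have hxi : x i ≠ 0 := fun h => by
        have := hxlow i hi
        rw [h, abs_zero] at this
        linarith
      simp [hη, hi, hxi]
  have hηsq : ∀ i, τ * η i ^ 2 ≤ 3 / 8 := fun i => by
    by_cases hi : xbar i = 0
    · have h1 : (A *ᵥ x) i ^ 2 ≤ (c / 16) ^ 2 := by
        rw [hAv, hi, mul_zero, zero_add]
        exact (hEx i).trans (by gcongr)
      simp only [hη, hi, if_true]
      rw [div_pow, mul_div_assoc', div_le_iff₀ (by positivity)]
      have h2 : (c / 16) ^ 2 ≤ 3 / 8 * τ := by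
        rw [hτ]
        nlinarith [sq_nonneg c]
      nlinarith
    · have h1 : (3 / 4 * c) ^ 2 ≤ x i ^ 2 := by
        rw [← sq_abs (x i)]
        exact pow_le_pow_left₀ (by positivity) (hxlow i hi) 2
      have h2 : 0 < x i ^ 2 := lt_of_lt_of_le (by positivity) h1
      simp only [hη, hi, if_false]
      rw [inv_pow, ← div_eq_mul_inv, div_le_iff₀ h2, hτ]
      nlinarith [sq_nonneg c]
  have hxfeas : WithLp.toLp 2 x ∈ spcaFeasible n k := by
    refine ⟨?_, (norm_eq_one_iff_dotProduct _).2 hx⟩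
    rw [← hcard]
    unfold zeroNorm hammingNorm
    refine Finset.card_le_card fun i hi => ?_
    simp only [Finset.mem_filter, Finset.mem_univ, true_and] at hi ⊢
    exact fun h => hi (hxs i h)
  refine ⟨WithLp.toLp 2 x, hxfeas, fun X hX hne => ?_⟩
  rw [traceInner_outer A]
  refine lt_of_lt_of_eq (traceInner_lt_of_certificate hk hA (μ := μ) (η := η) hx hτ0.le
    (by norm_num : (0 : ℝ) < 1 / 8) (fun i => ?_) (fun v hv => ?_) hX hne) hμx.symm
  · rw [hηx]
    have hk' : (k : ℝ) ≠ 0 := by exact_mod_cast hk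
    by_cases hi : xbar i = 0
    · simp [hη, hi, hxs i hi]
      field_simp
    · have hxi : x i ≠ 0 := fun h => by
        have := hxlow i hi
        rw [h, abs_zero] at this
        linarith
      simp [hη, hi, heig i hi]
      field_simp
      ring
  · have hvv : 0 ≤ v ⬝ᵥ v := Finset.sum_nonneg fun i _ => mul_self_nonneg _
    have h1 : (xbar.ofLp ⬝ᵥ v) ^ 2 ≤ 2 * e * (v ⬝ᵥ v) := by
      refine (sq_dotProduct_le_of_orthogonal hx hv xbar.ofLp).trans ?_
      rw [hxx, ← ha]
      gcongr
      linarith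
    have h2 : τ * ∑ i, η i ^ 2 * v i ^ 2 ≤ 3 / 8 * (v ⬝ᵥ v) := by
      simp only [dotProduct, Finset.mul_sum]
      refine Finset.sum_le_sum fun i _ => ?_
      have := mul_le_mul_of_nonneg_right (hηsq i) (mul_self_nonneg (v i))
      linarith
    have h3 := (abs_le.1 (hEq v)).2
    have h4 : (1 - e) * (v ⬝ᵥ v) ≤ μ * (v ⬝ᵥ v) := by
      gcongr
      linarith
    have h5 : e * (v ⬝ᵥ v) ≤ 1 / 16 * (v ⬝ᵥ v) := by
      gcongr
      linarith
    rw [hAq]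
    linarith

theorem SdpExact.smul_add_smul_one {n k : ℕ} {A : Matrix (Fin n) (Fin n) ℝ} {b : ℝ} (hb : 0 < b)
    (r : ℝ) {x : EuclideanSpace ℝ (Fin n)} (hx : x ∈ spcaFeasible n k)
    (h : ∀ X ∈ sdpFeasible n k, X ≠ outer x → traceInner A X < traceInner A (outer x)) :
    SdpExact (b • A + r • (1 : Matrix (Fin n) (Fin n) ℝ)) k := by
  have key : ∀ X ∈ sdpFeasible n k,
      traceInner (b • A + r • (1 : Matrix (Fin n) (Fin n) ℝ)) X = b * traceInner A X + r := by
    intro X hX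
    simp [traceInner, mul_add, hX.1]
  refine .of_strict hx fun X hX hne => ?_
  rw [key X hX, key _ (outer_mem_sdpFeasible hx)]
  gcongr
  exact h X hX hne

theorem half_inv_le {c : ℝ} (hc : 0 < c) :
    1 / 2 * (3 / 2 + (3 + 4 * Real.sqrt 2) / c)⁻¹ ≤ c / 16 := by
  have h2 : (5 / 4 : ℝ) ≤ Real.sqrt 2 := Real.le_sqrt_of_sq_le (by norm_num)
  have h : 8 / c ≤ 3 / 2 + (3 + 4 * Real.sqrt 2) / c := by
    have : 8 / c ≤ (3 + 4 * Real.sqrt 2) / c := by gcongr; linarith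
    linarith
  calc 1 / 2 * (3 / 2 + (3 + 4 * Real.sqrt 2) / c)⁻¹ ≤ 1 / 2 * (8 / c)⁻¹ := by
        gcongr
    _ = c / 16 := by rw [inv_div]; ring

end SparsePCA

theorem mainTheorem6 (n k : ℕ) (hk : 2 ≤ k)
    (xbar : EuclideanSpace ℝ (Fin n))
    (hcard : SparsePCA.zeroNorm xbar = k) (hnorm : ‖xbar‖ = 1)
    (β t : ℝ) (hβ : 0 ≤ β)
    (c : ℝ) (hc : IsLeast ((fun i => |xbar i|) '' {i | xbar i ≠ 0}) c)
    (Sbar S : Matrix (Fin n) (Fin n) ℝ)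
    (hSbar : Sbar = β • SparsePCA.outer xbar + t • (1 : Matrix (Fin n) (Fin n) ℝ))
    (hS : S.IsSymm)
    (ν : ℝ)
    (hν : ν < min (1 / 2 * (3 / 2 + (3 + 4 * Real.sqrt 2) / c)⁻¹) (c ^ 2 / 4))
    (hclose : ‖SparsePCA.projLPerp (S - Sbar)‖ < ν * β) :
    SparsePCA.SdpExact S k := by
  obtain ⟨⟨i₀, hi₀, hci₀⟩, hcmin⟩ := hc
  have hc0 : 0 < c := hci₀ ▸ abs_pos.2 hi₀
  have hc1 : c ≤ 1 := by
    have h := PiLp.norm_apply_le xbar i₀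
    rw [hnorm, Real.norm_eq_abs] at h
    exact hci₀ ▸ h
  -- The strict inequality `hclose` excludes `β = 0`.
  have hβ0 : 0 < β := by
    refine hβ.lt_of_ne fun h => ?_
    rw [← h, mul_zero] at hclose
    exact hclose.not_ge (norm_nonneg _)
  set F := SparsePCA.projLPerp (S - Sbar) with hF
  obtain ⟨r, hr⟩ := SparsePCA.sub_projLPerp_mem (S - Sbar)
  have hSF : S = β • (SparsePCA.outer xbar + β⁻¹ • F)
      + (t + r) • (1 : Matrix (Fin n) (Fin n) ℝ) := by
    rw [← hF] at hr
    have h : S = Sbar + (F + r • (1 : Matrix (Fin n) (Fin n) ℝ)) := by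
      rw [← hr]
      abel
    rw [smul_add, smul_inv_smul₀ hβ0.ne', add_smul]
    conv_lhs => rw [h, hSbar]
    abel
  have hSbarsymm : Sbar.IsSymm := by
    have h : (SparsePCA.outer xbar).IsSymm := Matrix.transpose_vecMulVec _ _
    rw [hSbar]
    exact (h.smul β).add (Matrix.isSymm_one.smul t)
  have hFsymm : F.IsSymm := (hS.sub hSbarsymm).sub (Matrix.isSymm_one.smul _)
  have hEnorm : ‖β⁻¹ • F‖ ≤ c / 16 := by
    rw [norm_smul, norm_inv, Real.norm_of_nonneg hβ, inv_mul_le_iff₀ hβ0]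
    have hνc : ν ≤ c / 16 :=
      (hν.trans_le (min_le_left _ _)).le.trans (SparsePCA.half_inv_le hc0)
    nlinarith
  obtain ⟨x, hx, hmax⟩ := SparsePCA.exists_strict_maximizer (by omega) hcard hnorm hc0 hc1
    (fun i hi => hcmin ⟨i, hi, rfl⟩) (hFsymm.smul β⁻¹) hEnorm
  rw [hSF]
  exact SparsePCA.SdpExact.smul_add_smul_one hβ0 _ hx hmax
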